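/- Let $\mathbb{K}$ be a field of characteristic zero. A line arrangement $\mathcal{A}$ in $\mathbf{P}^2_{\mathbb{K}}$ is a finite set of lines. Let $L_2(\mathcal{A})$ be the set of points of $\mathbf{P}^2_{\mathbb{K}}$ that are intersections of lines of $\mathcal{A}$, and for $p\in L_2(\mathcal{A})$ let $\mathcal{A}_p=\{H\in\mathcal{A}\mid p\in H\}$ and $\mu(p)=|\mathcal{A}_p|-1$. Let $n_2(\mathcal{A})$ be the number of double points of $\mathcal{A}$, that is, of points $p\in L_2(\mathcal{A})$ with $\mu(p)=1$. A point $p\in L_2(\mathcal{A})$ is modular if for all distinct $H,L\in\mathcal{A}\setminus\mathcal{A}_p$ there is a unique $K\in\mathcal{A}_p$ with $H\cap L\subset K$; $\mathcal{A}$ is supersolvable if it has a modular point. $\mathcal{A}$ is a pencil if all its lines pass through one common point. Let $\mathcal{A}$ be a supersolvable line arrangement in $\mathbf{P}^2_{\mathbb{K}}$ with a modular point $p$ such that $\mu(p)\ge 1$, let $H\in\mathcal{A}$, and let $\mathcal{A}'=\mathcal{A}\setminus\{H\}$. If $\mathcal{A}'$ is not a pencil, then $n_2(\mathcal{A}')>0$.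 In particular, call an arrangement nearly supersolvable if it is not a pencil, is not supersolvable, and is of the form $\mathcal{A}\setminus\{H\}$ with $\mathcal{A}$ supersolvable and $H\in\mathcal{A}$. Then $n_2(\mathcal{B})>0$ for every nearly supersolvable line arrangement $\mathcal{B}$ in $\mathbf{P}^2_{\mathbb{K}}$. -/

import Mathlib

/-- A line arrangement in the projective plane over `K`, given, equivalently, as a finite set of
linear planes in `K ^ 3`. Projective points are the one-dimensional subspaces of `K ^ 3`, and
a point `p` lies on a line `H` when `p ≤ H`. -/
structure LineArrangement (K : Type*) [Field K] where
  lines : Set (Submodule K (Fin 3 → K))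
  finite_lines : lines.Finite
  finrank_lines : ∀ H ∈ lines, Module.finrank K H = 2

namespace LineArrangement

variable {K : Type*} [Field K]

/-- The intersection lattice: all intersections of subsets of the arrangement; the empty
intersection is the whole space. -/
def intersectionLattice (A : LineArrangement K) : Set (Submodule K (Fin 3 → K)) :=
  {X | ∃ B : Set (Submodule K (Fin 3 → K)), B ⊆ A.lines ∧ X = sInf B}

/-- The elements of codimension two in the intersection lattice, that is, the projective points
that are intersections of lines of the arrangement. -/
def points (A : LineArrangement K) : Set (Submodule K (Fin 3 → K)) :=
  {X | X ∈ A.intersectionLattice ∧ Module.finrank K X = 1}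

/-- The lines of the arrangement that pass through `p`. -/
def linesThrough (A : LineArrangement K) (p : Submodule K (Fin 3 → K)) :
    Set (Submodule K (Fin 3 → K)) :=
  {H | H ∈ A.lines ∧ p ≤ H}

/-- The Möbius function: the number of lines through `p`, minus one. -/
noncomputable def mu (A : LineArrangement K) (p : Submodule K (Fin 3 → K)) : ℤ :=
  ((A.linesThrough p).ncard : ℤ) - 1

/-- The double points of the arrangement: the points that lie on exactly two of its lines. -/
def doublePoints (A : LineArrangement K) : Set (Submodule K (Fin 3 → K)) :=
  {p | p ∈ A.points ∧ A.mu p = 1}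

/-- The number of double points. The set counted is finite, because the lattice of a finite
arrangement is. -/
noncomputable def n2 (A : LineArrangement K) : ℕ := A.doublePoints.ncard

/-- `p` is a modular point: any two distinct lines of the arrangement that avoid `p` meet on
a unique line of the arrangement through `p`. -/
def IsModularPoint (A : LineArrangement K) (p : Submodule K (Fin 3 → K)) : Prop :=
  p ∈ A.points ∧
    ∀ H ∈ A.lines \ A.linesThrough p, ∀ L ∈ A.lines \ A.linesThrough p, H ≠ L →
      ∃! N : Submodule K (Fin 3 → K), N ∈ A.linesThrough p ∧ H ⊓ L ≤ N

/-- An arrangement is supersolvable if it has a modular point. -/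
def IsSupersolvable (A : LineArrangement K) : Prop :=
  ∃ p, A.IsModularPoint p

/-- All lines of the arrangement pass through one common projective point. -/
def IsPencil (A : LineArrangement K) : Prop :=
  ∃ q : Submodule K (Fin 3 → K), Module.finrank K q = 1 ∧ ∀ H ∈ A.lines, q ≤ H

/-- The arrangement with the line `H` removed. -/
def delete (A : LineArrangement K) (H : Submodule K (Fin 3 → K)) : LineArrangement K where
  lines := A.lines \ {H}
  finite_lines := A.finite_lines.subset Set.sdiff_subset
  finrank_lines := fun L hL => A.finrank_lines L hL.1

/-- `B` is nearly supersolvable: it is not a pencil, it is not supersolvable, and it is obtained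
from a supersolvable arrangement by removing one line. -/
def IsNearlySupersolvable (B : LineArrangement K) : Prop :=
  ¬ B.IsPencil ∧ ¬ B.IsSupersolvable ∧
    ∃ A : LineArrangement K, A.IsSupersolvable ∧ ∃ H ∈ A.lines, B = A.delete H

end LineArrangement

/-! The core is `exists_simple_point`. Send the modular point to infinity: the lines through it
become `x = a` with `a ∈ D`, `d = |D|`, and the others become graphs `y = b x + c` meeting only over
`D`. Then every graph has a point over `D` lying on no other graph.

Let `P = ∏ (x - a)`. In homogeneous coordinates the derivation `x ↦ P_z`, `z ↦ -P_x`, `y ↦ u` is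
tangent to the lines `x = a z`; it is tangent to a graph when `u` restricts there to `b P_z - c
P_x`, which at `z = 1` is `tangentValue` by Euler's formula. Interpolating one graph at a time
(`exists_tangent`) gives such a `u` of degree at most `d - 1`. If a graph met another one at each of
its points over `D`, comparing `u` on the two graphs to first order would give `u_y = (d - 1) P'` at
`d` points. Both sides have degree below `d`, so they would agree; but `u_y` has degree at most `d -
2`, while `(d - 1) P'` has leading coefficient `(d - 1) d ≠ 0` in characteristic zero.

After deleting `H`, such a point is double unless its line through `p` is `H`. If it is `H` for
every graph, the graphs meet only off `H`, and the same fact applies to the pencil without `H`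
(`n2_delete_pos`). -/

/-! ### Total degree of polynomials in two variables -/

open Polynomial in
/-- `u`, a polynomial in `y` over `R[x]`, has total degree at most `n`. -/
def TotalDegreeLE {R : Type*} [Semiring R] (n : ℕ) (u : R[X][X]) : Prop :=
  ∀ i j, n < i + j → (u.coeff i).coeff j = 0

namespace TotalDegreeLE

open Polynomial

variable {R : Type*} [CommRing R] {m n : ℕ} {u v : R[X][X]}

theorem add (hu : TotalDegreeLE n u) (hv : TotalDegreeLE n v) : TotalDegreeLE n (u + v) := by
  intro i j h
  simp [hu i j h, hv i j h]

theorem mul (hu : TotalDegreeLE m u) (hv : TotalDegreeLE n v) :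
    TotalDegreeLE (m + n) (u * v) := by
  intro i j h
  rw [coeff_mul, finsetSum_coeff]
  refine Finset.sum_eq_zero fun x hx => ?_
  rw [coeff_mul]
  refine Finset.sum_eq_zero fun y hy => ?_
  have hx := Finset.HasAntidiagonal.mem_antidiagonal.1 hx
  have hy := Finset.HasAntidiagonal.mem_antidiagonal.1 hy
  rcases lt_or_ge m (x.1 + y.1) with h1 | h1
  · rw [hu _ _ h1, zero_mul]
  · rw [hv _ _ (by omega), mul_zero]

theorem const {g : R[X]} (hg : g.natDegree ≤ n) : TotalDegreeLE n (C g) := by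
  intro i j h
  rw [coeff_C]
  split_ifs with hi
  · exact coeff_eq_zero_of_natDegree_lt (by omega)
  · simp

theorem X_sub_C {g : R[X]} (hg : g.natDegree ≤ 1) : TotalDegreeLE 1 (X - C g) := by
  intro i j h
  rw [coeff_sub, coeff_sub, const hg i j h, sub_zero, coeff_X]
  split_ifs with hi
  · rw [coeff_one, if_neg (by omega)]
  · simp

theorem prod_X_sub_C {ι : Type*} (s : Finset ι) {f : ι → R[X]}
    (hf : ∀ i ∈ s, (f i).natDegree ≤ 1) : TotalDegreeLE s.card (∏ i ∈ s, (X - C (f i) : R[X][X])) := by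
  classical
  induction s using Finset.induction_on with
  | empty => simpa using const (R := R) (n := 0) (g := 1) (by simp)
  | insert a s ha ih =>
    rw [Finset.prod_insert ha, Finset.card_insert_of_notMem ha, add_comm]
    exact (X_sub_C (hf a (by simp))).mul (ih fun i hi => hf i (by simp [hi]))

theorem derivative (hu : TotalDegreeLE (n + 1) u) : TotalDegreeLE n (derivative u) := by
  intro i j h
  rw [coeff_derivative]
  have : ((i : R[X]) + 1) = C ((i : R) + 1) := by simp
  rw [this, coeff_mul_C, hu _ _ (by omega), zero_mul]

theorem natDegree_eval_le (hu : TotalDegreeLE n u) {f : R[X]} (hf : f.natDegree ≤ 1) :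
    (u.eval f).natDegree ≤ n := by
  rw [eval_eq_sum]
  refine natDegree_sum_le_of_forall_le _ _ fun i _ => ?_
  by_cases h0 : u.coeff i = 0
  · simp [h0]
  have hi : i ≤ n := by
    by_contra hi
    exact h0 (ext fun j => by simpa using hu i j (by omega))
  have h1 : (u.coeff i).natDegree ≤ n - i :=
    natDegree_le_iff_coeff_eq_zero.2 fun j hj => hu i j (by omega)
  calc (u.coeff i * f ^ i).natDegree ≤ (n - i) + i * 1 :=
        natDegree_mul_le_of_le h1 (natDegree_pow_le_of_le i hf)
    _ = n := by omega

end TotalDegreeLE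

/-! ### Tangent derivations and simple points in affine coordinates -/

section LinearPolynomials

open Polynomial

variable {K : Type*} [Field K]

/-- The polynomial `b x + c`. -/
noncomputable def linPoly (s : K × K) : K[X] := C s.1 * X + C s.2

theorem natDegree_linPoly_le (s : K × K) : (linPoly s).natDegree ≤ 1 := natDegree_linear_le

theorem eval_linPoly (s : K × K) (a : K) : (linPoly s).eval a = s.1 * a + s.2 := by
  simp [linPoly]

theorem linPoly_eq (s : K × K) (a : K) :
    linPoly s = C (s.1 * a + s.2) + C s.1 * (X - C a) := by
  simp only [linPoly, map_add, map_mul]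
  ring

/-- The polynomial with simple roots at the points of `D`. -/
noncomputable def rootPoly (D : Finset K) : K[X] := ∏ a ∈ D, (X - C a)

theorem monic_rootPoly (D : Finset K) : (rootPoly D).Monic :=
  monic_prod_of_monic _ _ fun a _ => monic_X_sub_C a

theorem natDegree_rootPoly (D : Finset K) : (rootPoly D).natDegree = D.card := by
  simp [rootPoly]

theorem X_sub_C_dvd_rootPoly {D : Finset K} {a : K} (ha : a ∈ D) : X - C a ∣ rootPoly D :=
  Finset.dvd_prod_of_mem _ ha

/-- The value that a derivation tangent to all lines `y = b x + c` takes on `y`, restricted to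
the line. -/
noncomputable def tangentValue (D : Finset K) (s : K × K) : K[X] :=
  C ((D.card : K) * s.1) * rootPoly D - linPoly s * derivative (rootPoly D)

/-- The factor `D.card` makes the two terms of degree `D.card` cancel. -/
theorem natDegree_tangentValue_le {D : Finset K} (hD : 0 < D.card) (s : K × K) :
    (tangentValue D s).natDegree ≤ D.card - 1 := by
  rw [natDegree_le_iff_coeff_eq_zero]
  intro j hj
  have hP : ∀ j, D.card < j → (rootPoly D).coeff j = 0 := fun j hj =>
    coeff_eq_zero_of_natDegree_lt (by rwa [natDegree_rootPoly])
  obtain ⟨i, rfl⟩ : ∃ i, j = i + 1 := ⟨j - 1, by omega⟩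
  have h2 : (rootPoly D).coeff (i + 1 + 1) = 0 := hP _ (by omega)
  simp only [tangentValue, linPoly, coeff_sub, coeff_C_mul, add_mul, coeff_add, mul_assoc,
    coeff_X_mul, coeff_derivative, h2]
  rcases eq_or_ne (i + 1) D.card with h | h
  · rw [← h]; push_cast; ring
  · rw [hP (i + 1) (by omega)]; ring

theorem fst_ne_of_meet {s t : K × K} (hst : s ≠ t) {a : K}
    (h : s.1 * a + s.2 = t.1 * a + t.2) : s.1 ≠ t.1 := by
  intro h1
  rw [h1] at h
  exact hst (Prod.ext h1 (add_left_cancel h))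

open Classical in
/-- The lines of `S` that meet `s` over `a` contribute their full multiplicity to the defect of
tangency along `s`. -/
theorem prod_fiber_dvd {D : Finset K} {S : Finset (K × K)} {u : K[X][X]}
    (hu : ∀ t ∈ S, u.eval (linPoly t) = tangentValue D t) (s : K × K) {a : K}
    (ha : a ∈ D) :
    ∏ t ∈ S with t.1 * a + t.2 = s.1 * a + s.2, (linPoly s - linPoly t) ∣
      tangentValue D s - u.eval (linPoly s) := by
  obtain ⟨Q, hQ⟩ := X_sub_C_dvd_rootPoly ha
  set e : K := s.1 * a + s.2 with he
  set F := S.filter fun t => t.1 * a + t.2 = e with hF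
  -- A line of slope `b` through `(a, e)` is `y = e + Y` with `Y = b (x - a)`. Since `x - a` divides
  -- `P`, its defect of tangency is a polynomial `w` in `Y` that is the same for all these lines.
  let w : K[X][X] := C (C (D.card : K) * Q) * X - (C (C e) + X) * C (derivative (rootPoly D)) -
    u.comp (C (C e) + X)
  have hw : ∀ t : K × K, t.1 * a + t.2 = e →
      w.eval (C t.1 * (X - C a)) = tangentValue D t - u.eval (linPoly t) := by
    intro t ht
    have h1 := linPoly_eq t a
    rw [ht] at h1
    simp only [w, eval_sub, eval_mul, eval_add, eval_C, eval_X, eval_comp, ← h1, tangentValue]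
    rw [hQ]
    simp only [map_mul]
    ring
  have hinj : Set.InjOn (fun t : K × K => (C t.1 * (X - C a) : K[X])) F := by
    intro t ht t' ht' h
    have hC : (C t.1 : K[X]) = C t'.1 := mul_right_cancel₀ (X_sub_C_ne_zero a) h
    by_contra hne
    simp only [hF, Finset.coe_filter, Set.mem_ofPred_eq] at ht ht'
    exact fst_ne_of_meet hne (ht.2.trans ht'.2.symm) (C_injective hC)
  have hdvd : ∏ t ∈ F, (X - C (C t.1 * (X - C a) : K[X])) ∣ w := by
    refine Finset.prod_dvd_of_isRelPrime ?_ ?_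
    · intro t ht t' ht' hne
      exact (irreducible_X_sub_C _).isRelPrime_iff_not_dvd.2 fun h => by
        rw [dvd_iff_isRoot, IsRoot, eval_sub, eval_X, eval_C, sub_eq_zero] at h
        exact hne (hinj ht ht' h)
    · intro t ht
      rw [hF, Finset.mem_filter] at ht
      rw [dvd_iff_isRoot, IsRoot, hw t ht.2, hu t ht.1, sub_self]
  have := eval_dvd (x := (C s.1 * (X - C a) : K[X])) hdvd
  rw [hw s rfl, eval_prod] at this
  refine (Finset.prod_congr rfl fun t ht => ?_).dvd.trans this
  rw [hF, Finset.mem_filter] at ht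
  rw [linPoly_eq s a, linPoly_eq t a, ht.2, ← he, eval_sub, eval_X, eval_C]
  ring

open Classical in
/-- A family of lines meeting only over `D` admits a tangent derivation of degree `|D| - 1`. -/
theorem exists_tangent {D : Finset K} (hD : 0 < D.card) (S : Finset (K × K))
    (hS : ∀ s ∈ S, ∀ t ∈ S, s ≠ t → ∃ a ∈ D, s.1 * a + s.2 = t.1 * a + t.2) :
    ∃ u : K[X][X], TotalDegreeLE (D.card - 1) u ∧
      ∀ s ∈ S, u.eval (linPoly s) = tangentValue D s := by
  induction S using Finset.induction_on with
  | empty => exact ⟨0, fun i j _ => by simp, by simp⟩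
  | insert s S hs ih =>
    obtain ⟨u, hdeg, hu⟩ := ih fun t ht t' ht' =>
      hS t (Finset.mem_insert_of_mem ht) t' (Finset.mem_insert_of_mem ht')
    have hmeet : ∀ t ∈ S, ∃ a ∈ D, t.1 * a + t.2 = s.1 * a + s.2 := fun t ht =>
      hS t (Finset.mem_insert_of_mem ht) s (Finset.mem_insert_self _ _)
        (fun h => hs (h ▸ ht))
    have hne : ∀ t ∈ S, s.1 - t.1 ≠ 0 := fun t ht => by
      obtain ⟨a, -, ha⟩ := hmeet t ht
      exact sub_ne_zero.2 (fst_ne_of_meet (fun h : t = s => hs (h ▸ ht)) ha).symm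
    choose! α hαD hα using hmeet
    have hfac : ∀ t ∈ S, linPoly s - linPoly t = C (s.1 - t.1) * (X - C (α t)) := fun t ht => by
      rw [linPoly_eq s (α t), linPoly_eq t (α t), hα t ht, map_sub]
      ring
    have hdvd : ∏ t ∈ S, (linPoly s - linPoly t) ∣ tangentValue D s - u.eval (linPoly s) := by
      -- Group the lines by the point where they meet `s`; factors over different points are
      -- coprime.
      rw [← Finset.prod_fiberwise_of_maps_to hαD]
      refine Finset.prod_dvd_of_coprime ?_ ?_
      · intro a _ b _ hab
        refine IsCoprime.prod_left fun t ht => IsCoprime.prod_right fun t' ht' => ?_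
        rw [Finset.mem_filter] at ht ht'
        rw [hfac t ht.1, hfac t' ht'.1, ht.2, ht'.2]
        have h1 := isUnit_C.2 (hne t ht.1).isUnit
        have h2 := isUnit_C.2 (hne t' ht'.1).isUnit
        rw [isCoprime_mul_unit_left_left h1, isCoprime_mul_unit_left_right h2]
        exact isCoprime_X_sub_C_of_isUnit_sub (sub_ne_zero.2 hab).isUnit
      · intro a ha
        refine (Finset.prod_dvd_prod_of_subset _ _ _ ?_).trans (prod_fiber_dvd hu s ha)
        intro t ht
        rw [Finset.mem_filter] at ht ⊢
        exact ⟨ht.1, ht.2 ▸ hα t ht.1⟩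
    obtain ⟨g, hg⟩ := hdvd
    have hprod : ∏ t ∈ S, (linPoly s - linPoly t) ≠ 0 := Finset.prod_ne_zero_iff.2 fun t ht => by
      rw [hfac t ht]
      exact mul_ne_zero (C_ne_zero.2 (hne t ht)) (X_sub_C_ne_zero _)
    have hprodDeg : (∏ t ∈ S, (linPoly s - linPoly t)).natDegree = S.card := by
      rw [natDegree_prod _ _ (Finset.prod_ne_zero_iff.1 hprod), Finset.card_eq_sum_ones]
      refine Finset.sum_congr rfl fun t ht => ?_
      rw [hfac t ht, natDegree_C_mul (hne t ht), natDegree_X_sub_C]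
    have hcorr : TotalDegreeLE (D.card - 1) (C g * ∏ t ∈ S, (X - C (linPoly t))) := by
      -- Only a nonzero `g` forces `S.card ≤ D.card - 1`, which the truncated subtraction below
      -- needs.
      by_cases hg0 : g = 0
      · simpa [hg0] using TotalDegreeLE.const (R := K) (n := D.card - 1) (g := 0) (by simp)
      have hle : (tangentValue D s - u.eval (linPoly s)).natDegree ≤ D.card - 1 :=
        (natDegree_sub_le _ _).trans (max_le (natDegree_tangentValue_le hD s)
          (hdeg.natDegree_eval_le (natDegree_linPoly_le s)))
      rw [hg, natDegree_mul hprod hg0, hprodDeg] at hle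
      have := (TotalDegreeLE.const (n := D.card - 1 - S.card) (g := g) (by omega)).mul
        (TotalDegreeLE.prod_X_sub_C S (f := linPoly) fun t _ => natDegree_linPoly_le t)
      rwa [Nat.sub_add_cancel (by omega)] at this
    refine ⟨u + C g * ∏ t ∈ S, (X - C (linPoly t)), hdeg.add hcorr, ?_⟩
    intro t ht
    rw [eval_add, eval_mul, eval_C, eval_prod]
    simp only [eval_sub, eval_X, eval_C]
    rcases Finset.mem_insert.1 ht with rfl | ht
    · linear_combination -hg
    · rw [Finset.prod_eq_zero (f := fun x => linPoly t - linPoly x) ht (sub_self _), mul_zero, add_zero, hu t ht]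

/-- If lines `y = b x + c` meet only over the points of `D`, each of them has a point over `D`
that lies on no other line. -/
theorem exists_simple_point [CharZero K] {D : Finset K} (hD : 2 ≤ D.card) {S : Finset (K × K)}
    (hS : ∀ s ∈ S, ∀ t ∈ S, s ≠ t → ∃ a ∈ D, s.1 * a + s.2 = t.1 * a + t.2)
    {s : K × K} (hs : s ∈ S) :
    ∃ a ∈ D, ∀ t ∈ S, t ≠ s → t.1 * a + t.2 ≠ s.1 * a + s.2 := by
  by_contra! hcon
  obtain ⟨u, hdeg, hu⟩ := exists_tangent (by omega) S hS
  obtain ⟨n, hn⟩ : ∃ n, D.card = n + 2 := ⟨D.card - 2, by omega⟩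
  set P := rootPoly D with hP
  set v := (derivative u).eval (linPoly s) with hv
  have hvdeg : v.natDegree ≤ n :=
    TotalDegreeLE.natDegree_eval_le (TotalDegreeLE.derivative (by rwa [hn] at hdeg))
      (natDegree_linPoly_le s)
  have hroot : ∀ a ∈ D, (C ((n : K) + 1) * derivative P - v).eval a = 0 := by
    intro a ha
    obtain ⟨t, ht, hts, hmeet⟩ := hcon a ha
    obtain ⟨Q, hQ⟩ := X_sub_C_dvd_rootPoly ha
    -- Taylor expansion in `y` from `s` to `t`: dividing by `t - s` and setting `x = a` isolates
    -- `u_y`.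
    obtain ⟨k, hk⟩ := u.binomExpansion (linPoly s) (linPoly t - linPoly s)
    have hne : t.1 - s.1 ≠ 0 := sub_ne_zero.2 (fst_ne_of_meet hts hmeet)
    have hfac : linPoly t - linPoly s = C (t.1 - s.1) * (X - C a) := by
      rw [linPoly_eq s a, linPoly_eq t a, hmeet, map_sub]
      ring
    rw [add_sub_cancel, hu t ht, hu s hs, ← hv] at hk
    have hdiff : tangentValue D t - tangentValue D s =
        (C (t.1 - s.1) * (X - C a)) * (C ((n : K) + 2) * Q - derivative P) := by
      rw [← hfac, tangentValue, tangentValue, ← hP, hn, mul_sub, hfac]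
      have : derivative P * (linPoly t - linPoly s) = derivative P * (C (t.1 - s.1) * (X - C a)) := by
        rw [hfac]
      rw [hP, hQ] at this ⊢
      simp only [map_mul, map_sub, Nat.cast_add, Nat.cast_ofNat] at this ⊢
      linear_combination -this
    have hcancel : C ((n : K) + 2) * Q - derivative P =
        v + k * (C (t.1 - s.1) * (X - C a)) := by
      refine mul_left_cancel₀ (mul_ne_zero (C_ne_zero.2 hne) (X_sub_C_ne_zero a)) ?_
      rw [← hdiff, hk, hfac]
      ring
    have hPa : (derivative P).eval a = Q.eval a := by
      rw [hP, hQ]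
      simp
    have := congrArg (eval a) hcancel
    simp only [eval_sub, eval_mul, eval_add, eval_C, eval_X, sub_self, mul_zero, add_zero,
      hPa] at this
    simp only [eval_sub, eval_mul, eval_C, hPa]
    linear_combination this
  have hPdeg : (derivative P).natDegree ≤ n + 1 := by
    have := natDegree_derivative_le P
    rw [hP, natDegree_rootPoly, hn] at this
    exact this
  have hzero : C ((n : K) + 1) * derivative P - v = 0 := by
    refine eq_zero_of_natDegree_lt_card_of_eval_eq_zero' _ D hroot ?_
    refine lt_of_le_of_lt (natDegree_sub_le_of_le (m := n + 1) (n := n + 1) ?_ (by omega)) ?_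
    · exact (natDegree_C_mul_le _ _).trans hPdeg
    · rw [max_self]; omega
  have hcoeff := congrArg (fun q => q.coeff (n + 1)) hzero
  have hlead : P.coeff (n + 1 + 1) = 1 := by
    have := (monic_rootPoly D).coeff_natDegree
    rwa [natDegree_rootPoly, hn] at this
  simp only [coeff_sub, coeff_C_mul, coeff_derivative, hlead, coeff_zero,
    coeff_eq_zero_of_natDegree_lt (show v.natDegree < n + 1 by omega), sub_zero, one_mul] at hcoeff
  norm_cast at hcoeff

end LinearPolynomials

/-! ### From planes in a three-dimensional space to affine coordinates -/

section Planes

variable {K V : Type*} [Field K] [AddCommGroup V] [Module K V]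

theorem exists_smul_eq_of_finrank_one {W : Submodule K V} (hW : Module.finrank K W = 1)
    {x y : V} (hx : x ∈ W) (hx0 : x ≠ 0) (hy : y ∈ W) : ∃ c : K, c • x = y := by
  obtain ⟨c, hc⟩ := (finrank_eq_one_iff_of_nonzero' (⟨x, hx⟩ : W) (by simpa using hx0)).1 hW ⟨y, hy⟩
  exact ⟨c, congrArg Subtype.val hc⟩

theorem le_of_finrank_eq_one {W U : Submodule K V} (hW : Module.finrank K W = 1) {x : V}
    (hx : x ∈ W) (hx0 : x ≠ 0) (hU : x ∈ U) : W ≤ U := by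
  intro y hy
  obtain ⟨c, rfl⟩ := exists_smul_eq_of_finrank_one hW hx hx0 hy
  exact U.smul_mem c hU

theorem exists_ne_zero_of_finrank_eq_one {W : Submodule K V} (hW : Module.finrank K W = 1) :
    ∃ x ∈ W, x ≠ 0 := by
  refine W.exists_mem_ne_zero_of_ne_bot ?_
  rintro rfl
  simp at hW

theorem eq_of_mem_add_smul {H : Submodule K V} {w x : V} {a b : K} (hw : w ∉ H)
    (ha : x + a • w ∈ H) (hb : x + b • w ∈ H) : a = b := by
  by_contra hab
  have h := H.sub_mem ha hb
  rw [add_sub_add_left_eq_sub, ← sub_smul] at h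
  exact hw ((H.smul_mem_iff (sub_ne_zero.2 hab)).1 h)

variable [FiniteDimensional K V]

theorem finrank_inf_of_planes (hV : Module.finrank K V = 3) {H L : Submodule K V}
    (hH : Module.finrank K H = 2) (hL : Module.finrank K L = 2) (hne : H ≠ L) :
    Module.finrank K ↑(H ⊓ L) = 1 := by
  have h1 := Submodule.finrank_sup_add_finrank_inf_eq H L
  have h2 := Submodule.finrank_le (H ⊔ L)
  have h3 : Module.finrank K H < Module.finrank K ↑(H ⊔ L) := by
    refine Submodule.finrank_lt_finrank_of_lt (lt_of_le_of_ne le_sup_left fun h => hne ?_)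
    exact (Submodule.eq_of_le_of_finrank_eq (h ▸ le_sup_right) (by rw [hH, hL])).symm
  omega

theorem exists_add_smul_mem (hV : Module.finrank K V = 3) {H : Submodule K V}
    (hH : Module.finrank K H = 2) {w : V} (hw : w ∉ H) (x : V) : ∃ a : K, x + a • w ∈ H := by
  have htop : H ⊔ K ∙ w = ⊤ := by
    refine Submodule.eq_top_of_finrank_eq (le_antisymm (Submodule.finrank_le _) ?_)
    have : Module.finrank K H < Module.finrank K ↑(H ⊔ K ∙ w) := by
      refine Submodule.finrank_lt_finrank_of_lt (lt_of_le_of_ne le_sup_left fun h => hw ?_)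
      rw [h]
      exact Submodule.mem_sup_right (Submodule.mem_span_singleton_self w)
    omega
  obtain ⟨y, hy, z, hz, rfl⟩ := Submodule.mem_sup.1 (htop ▸ Submodule.mem_top : x ∈ H ⊔ K ∙ w)
  obtain ⟨c, rfl⟩ := Submodule.mem_span_singleton.1 hz
  exact ⟨-c, by simpa [add_assoc] using hy⟩

open Classical in
/-- Let planes in a three-dimensional space that avoid `v` intersect pairwise within a finite
family of at least two planes through `v`. Then each of them meets some plane of that family in
a line that no other plane avoiding `v` contains. -/
theorem exists_simple_intersection [CharZero K] (hV : Module.finrank K V = 3)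
    {D S : Finset (Submodule K V)} {v : V} (hv0 : v ≠ 0)
    (hD : ∀ H ∈ D, Module.finrank K H = 2 ∧ v ∈ H)
    (hS : ∀ L ∈ S, Module.finrank K L = 2 ∧ v ∉ L) (hcard : 2 ≤ D.card)
    (hmeet : ∀ L ∈ S, ∀ L' ∈ S, L ≠ L' → ∃ H ∈ D, L ⊓ L' ≤ H)
    {L : Submodule K V} (hL : L ∈ S) :
    ∃ H ∈ D, ∀ L' ∈ S, L' ≠ L → ¬ L ⊓ H ≤ L' := by
  -- This keeps every plane of `D` away from the plane at infinity, spanned by `e₁` and `v`. A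
  -- finite union of proper subspaces is not everything because `K` is infinite.
  obtain ⟨e₁, he₁⟩ : ∃ e₁ : V, ∀ H ∈ D, e₁ ∉ H := by
    have h := Subspace.biUnion_ne_univ_of_top_notMem (k := K) (s := D) fun h => by
      have := (hD _ h).1
      rw [finrank_top] at this
      omega
    obtain ⟨x, hx⟩ := (Set.ne_univ_iff_exists_notMem _).1 h
    exact ⟨x, fun H hH hxH => hx (Set.mem_biUnion hH hxH)⟩
  obtain ⟨e₂, he₂⟩ : ∃ e₂ : V, e₂ ∉ Submodule.span K ({e₁, v} : Set V) := by
    by_contra! h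
    have h1 := finrank_span_le_card (R := K) ({e₁, v} : Set V)
    rw [show Submodule.span K ({e₁, v} : Set V) = ⊤ from eq_top_iff.2 fun x _ => h x,
      finrank_top, hV] at h1
    have h2 : ({e₁, v} : Set V).toFinset.card ≤ 2 := by
      simpa using Finset.card_le_two (a := e₁) (b := v)
    omega
  have hindep : ∀ a c : K, e₂ ≠ a • e₁ + c • v := fun a c h =>
    he₂ (Submodule.mem_span_pair.2 ⟨a, c, h.symm⟩)
  have hex : ∀ H ∈ D, ∃ a : K, e₂ + a • e₁ ∈ H := fun H hH =>
    exists_add_smul_mem hV (hD H hH).1 (he₁ H hH) e₂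
  choose! α hα using hex
  have hαinj : Set.InjOn α D := by
    intro H hH H' hH' h
    by_contra hne
    have h1 := finrank_inf_of_planes hV (hD H hH).1 (hD H' hH').1 hne
    obtain ⟨c, hc⟩ := exists_smul_eq_of_finrank_one h1 ⟨(hD H hH).2, (hD H' hH').2⟩ hv0
      ⟨hα H hH, h ▸ hα H' hH'⟩
    exact hindep (-α H) c (by rw [hc, neg_smul]; abel)
  have hex : ∀ L ∈ S, ∃ s : K × K, e₁ + s.1 • v ∈ L ∧ e₂ + s.2 • v ∈ L := fun L hL => by
    obtain ⟨b, hb⟩ := exists_add_smul_mem hV (hS L hL).1 (hS L hL).2 e₁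
    obtain ⟨c, hc⟩ := exists_add_smul_mem hV (hS L hL).1 (hS L hL).2 e₂
    exact ⟨(b, c), hb, hc⟩
  choose! β hβ using hex
  have hpt : ∀ L ∈ S, ∀ a : K,
      (e₂ + a • e₁) + ((β L).1 * a + (β L).2) • v ∈ L := fun L hL a => by
    have := L.add_mem (hβ L hL).2 (L.smul_mem a (hβ L hL).1)
    convert this using 1
    module
  have hDS : ∀ L ∈ S, ∀ H ∈ D, Module.finrank K ↑(L ⊓ H) = 1 := fun L hL H hH =>
    finrank_inf_of_planes hV (hS L hL).1 (hD H hH).1 fun h => (hS L hL).2 (h ▸ (hD H hH).2)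
  have hptH : ∀ L ∈ S, ∀ H ∈ D,
      (e₂ + α H • e₁) + ((β L).1 * α H + (β L).2) • v ∈ L ⊓ H := fun L hL H hH =>
    ⟨hpt L hL _, H.add_mem (hα H hH) (H.smul_mem _ (hD H hH).2)⟩
  have key : ∀ L ∈ S, ∀ L' ∈ S, ∀ H ∈ D, L ⊓ H ≤ L' →
      (β L).1 * α H + (β L).2 = (β L').1 * α H + (β L').2 := fun L hL L' hL' H hH hle =>
    eq_of_mem_add_smul (hS L' hL').2 (hle (hptH L hL H hH)) (hpt L' hL' _)
  have hmeet' : ∀ L ∈ S, ∀ L' ∈ S, L ≠ L' →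
      ∃ H ∈ D, (β L).1 * α H + (β L).2 = (β L').1 * α H + (β L').2 := by
    intro L hL L' hL' hne
    obtain ⟨H, hH, hle⟩ := hmeet L hL L' hL' hne
    refine ⟨H, hH, key L hL L' hL' H hH ?_⟩
    rw [← Submodule.eq_of_le_of_finrank_eq (le_inf inf_le_left hle)
      (by rw [hDS L hL H hH, finrank_inf_of_planes hV (hS L hL).1 (hS L' hL').1 hne])]
    exact inf_le_right
  -- Equal coordinates would put `e₁ + b • v` and `e₂ + c • v` in a one-dimensional intersection.
  have hβ_ne : ∀ L ∈ S, ∀ L' ∈ S, L ≠ L' → β L ≠ β L' := by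
    intro L hL L' hL' hne h
    have h1 := finrank_inf_of_planes hV (hS L hL).1 (hS L' hL').1 hne
    obtain ⟨H, hH⟩ : D.Nonempty := Finset.card_pos.1 (by omega)
    have hb0 : e₁ + (β L).1 • v ≠ 0 := fun h0 => he₁ H hH <| by
      rw [eq_neg_of_add_eq_zero_left h0]
      exact H.neg_mem (H.smul_mem _ (hD H hH).2)
    obtain ⟨c, hc⟩ := exists_smul_eq_of_finrank_one h1
      ⟨(hβ L hL).1, h ▸ (hβ L' hL').1⟩ hb0 ⟨(hβ L hL).2, h ▸ (hβ L' hL').2⟩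
    refine hindep c (c * (β L).1 - (β L).2) ?_
    rw [eq_sub_of_add_eq hc.symm]
    module
  have hcard' : 2 ≤ (D.image α).card := by rwa [Finset.card_image_of_injOn hαinj]
  obtain ⟨a, ha, hsimple⟩ := exists_simple_point hcard' (S := S.image β) (by
    intro s hs t ht hst
    obtain ⟨M, hM, rfl⟩ := Finset.mem_image.1 hs
    obtain ⟨N, hN, rfl⟩ := Finset.mem_image.1 ht
    obtain ⟨H, hH, h⟩ := hmeet' M hM N hN fun h => hst (h ▸ rfl)
    exact ⟨α H, Finset.mem_image_of_mem _ hH, h⟩) (Finset.mem_image_of_mem β hL)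
  obtain ⟨H, hH, rfl⟩ := Finset.mem_image.1 ha
  refine ⟨H, hH, fun L' hL' hne hle => ?_⟩
  exact hsimple _ (Finset.mem_image_of_mem β hL') (hβ_ne L' hL' L hL hne)
    (key L hL L' hL' H hH hle).symm

end Planes

/-! ### Double points and deletion from a supersolvable arrangement -/

namespace LineArrangement

variable {K : Type*} [Field K]

theorem finite_doublePoints (A : LineArrangement K) : A.doublePoints.Finite := by
  refine (A.finite_lines.powerset.image sInf).subset ?_
  rintro X ⟨⟨⟨B, hB, rfl⟩, -⟩, -⟩
  exact Set.mem_image_of_mem _ hB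

theorem inf_mem_points (A : LineArrangement K) {H L : Submodule K (Fin 3 → K)}
    (hH : H ∈ A.lines) (hL : L ∈ A.lines) (hne : H ≠ L) : H ⊓ L ∈ A.points :=
  ⟨⟨{H, L}, by simp [Set.insert_subset_iff, hH, hL], sInf_pair.symm⟩,
    finrank_inf_of_planes (by simp) (A.finrank_lines H hH) (A.finrank_lines L hL) hne⟩

/-- Two lines give a double point if no third line passes through their intersection. -/
theorem n2_pos_of_inf (A : LineArrangement K) {H L : Submodule K (Fin 3 → K)}
    (hH : H ∈ A.lines) (hL : L ∈ A.lines) (hne : H ≠ L)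
    (h : ∀ M ∈ A.lines, H ⊓ L ≤ M → M = H ∨ M = L) : 0 < A.n2 := by
  refine (Set.ncard_pos A.finite_doublePoints).2 ⟨H ⊓ L, A.inf_mem_points hH hL hne, ?_⟩
  have : A.linesThrough (H ⊓ L) = {H, L} := by
    ext M
    constructor
    · rintro ⟨hM, hle⟩
      exact h M hM hle
    · rintro (rfl | rfl)
      · exact ⟨hH, inf_le_left⟩
      · exact ⟨hL, inf_le_right⟩
  rw [mu, this, Set.ncard_pair hne]
  norm_num

/-- A point of the lattice lies on at least two lines. -/
theorem one_le_mu {A : LineArrangement K} {p : Submodule K (Fin 3 → K)} (hp : p ∈ A.points) :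
    1 ≤ A.mu p := by
  obtain ⟨⟨B, hB, rfl⟩, hrank⟩ := hp
  have hsub : B ⊆ A.linesThrough (sInf B) := fun H hH => ⟨hB hH, sInf_le hH⟩
  have hfin : (A.linesThrough (sInf B)).Finite := A.finite_lines.subset fun H hH => hH.1
  have hle := Set.ncard_le_ncard hsub hfin
  have h2 : 2 ≤ B.ncard := by
    by_contra! hlt
    rcases (Set.ncard_le_one_iff_eq (hfin.subset hsub)).1 (by omega) with rfl | ⟨H, rfl⟩
    · rw [sInf_empty, finrank_top] at hrank
      simp at hrank
    · rw [sInf_singleton, A.finrank_lines H (hB rfl)] at hrank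
      omega
  rw [mu]
  omega

/-- If two lines meet on a third line, different from the first, they cut it in the same point. -/
theorem inf_eq_inf_of_le (A : LineArrangement K) {p L V M : Submodule K (Fin 3 → K)}
    (hL : L ∈ A.lines \ A.linesThrough p) (hV : V ∈ A.linesThrough p) (hM : M ∈ A.lines)
    (hne : L ≠ M) (hle : L ⊓ M ≤ V) : L ⊓ M = L ⊓ V := by
  have hLV := finrank_inf_of_planes (by simp) (A.finrank_lines L hL.1) (A.finrank_lines V hV.1)
    (fun h => hL.2 (h ▸ hV))
  have hLM := finrank_inf_of_planes (by simp) (A.finrank_lines L hL.1) (A.finrank_lines M hM) hne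
  exact Submodule.eq_of_le_of_finrank_eq (le_inf inf_le_left hle) (hLM.trans hLV.symm)

section Modular

variable {p : Submodule K (Fin 3 → K)}

/-- If a finite family of lines avoiding `p` meets pairwise on at least two lines through `p`,
each line of the family carries a point on one of the lines through `p` and on no other line of
the family. -/
theorem exists_inf_not_le [CharZero K] (A : LineArrangement K) (hp : Module.finrank K p = 1)
    {D S : Set (Submodule K (Fin 3 → K))} (hD : D ⊆ A.linesThrough p)
    (hS : S ⊆ A.lines \ A.linesThrough p) (hcard : 2 ≤ D.ncard)
    (hmeet : ∀ L ∈ S, ∀ L' ∈ S, L ≠ L' → ∃ H ∈ D, L ⊓ L' ≤ H)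
    {L : Submodule K (Fin 3 → K)} (hL : L ∈ S) :
    ∃ H ∈ D, ∀ L' ∈ S, L' ≠ L → ¬ L ⊓ H ≤ L' := by
  obtain ⟨v, hv, hv0⟩ := exists_ne_zero_of_finrank_eq_one hp
  have hDfin : D.Finite := A.finite_lines.subset fun H hH => (hD hH).1
  have hSfin : S.Finite := A.finite_lines.subset fun H hH => (hS hH).1
  have := exists_simple_intersection (K := K) (V := Fin 3 → K) (by simp)
    (D := hDfin.toFinset) (S := hSfin.toFinset) hv0 (L := L)
  simp only [Set.Finite.mem_toFinset] at this
  refine this (fun H hH => ⟨A.finrank_lines H (hD hH).1, (hD hH).2 hv⟩)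
    (fun L hL => ⟨A.finrank_lines L (hS hL).1, fun hvL => (hS hL).2 ⟨(hS hL).1, ?_⟩⟩) ?_ hmeet hL
  · exact le_of_finrank_eq_one hp hv hv0 hvL
  · rwa [← Set.ncard_eq_toFinset_card D hDfin]

/-- The line through `p` and a point of a line avoiding `p` is unique. -/
theorem eq_of_inf_le (A : LineArrangement K) (hp : Module.finrank K p = 1)
    {L V M : Submodule K (Fin 3 → K)} (hL : L ∈ A.lines \ A.linesThrough p)
    (hV : V ∈ A.linesThrough p) (hM : M ∈ A.linesThrough p) (hle : L ⊓ V ≤ M) : M = V := by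
  by_contra hne
  have hMV := finrank_inf_of_planes (by simp) (A.finrank_lines M hM.1) (A.finrank_lines V hV.1) hne
  have hLV := finrank_inf_of_planes (by simp) (A.finrank_lines L hL.1) (A.finrank_lines V hV.1)
    (fun h => hL.2 (h ▸ hV))
  have h1 := Submodule.eq_of_le_of_finrank_eq (le_inf hM.2 hV.2) (hp.trans hMV.symm)
  have h2 := Submodule.eq_of_le_of_finrank_eq (le_inf hle inf_le_right) (hLV.trans hMV.symm)
  exact hL.2 ⟨hL.1, h1.trans_le (h2.symm.trans_le inf_le_left)⟩

/-- `exists_inf_not_le` is used with all lines through `p`, and again without `H` when every simple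
point it yields lies on `H`. -/
theorem n2_delete_pos [CharZero K] {A : LineArrangement K} {H : Submodule K (Fin 3 → K)}
    (hmod : A.IsModularPoint p) (hmu : 1 ≤ A.mu p) (hpencil : ¬ (A.delete H).IsPencil) :
    0 < (A.delete H).n2 := by
  have hp : Module.finrank K p = 1 := hmod.1.2
  have hmeet := hmod.2
  have hcard : 2 ≤ (A.linesThrough p).ncard := by rw [mu] at hmu; omega
  obtain ⟨L, ⟨hLA, hLH⟩, hpL⟩ : ∃ L ∈ A.lines \ {H}, ¬ p ≤ L := by
    by_contra! h
    exact hpencil ⟨p, hp, h⟩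
  have hL : L ∈ A.lines \ A.linesThrough p := ⟨hLA, fun h => hpL h.2⟩
  have double : ∀ L ∈ (A.lines \ {H}) \ A.linesThrough p, ∀ V ∈ A.linesThrough p, V ≠ H →
      (∀ L' ∈ (A.lines \ {H}) \ A.linesThrough p, L' ≠ L → ¬ L ⊓ V ≤ L') →
      0 < (A.delete H).n2 := by
    intro L hL V hV hVH hsimple
    refine n2_pos_of_inf _ (H := L) (L := V) hL.1 ⟨hV.1, hVH⟩ (fun h => hL.2 (h ▸ hV)) ?_
    intro M hM hle
    by_cases hMp : M ∈ A.linesThrough p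
    · exact Or.inr (A.eq_of_inf_le hp ⟨hL.1.1, hL.2⟩ hV hMp hle)
    · by_contra! hne
      exact hsimple M ⟨hM, hMp⟩ hne.1 hle
  set S := (A.lines \ {H}) \ A.linesThrough p with hSdef
  have hSsub : S ⊆ A.lines \ A.linesThrough p := fun M hM => ⟨hM.1.1, hM.2⟩
  have hLS : L ∈ S := ⟨⟨hLA, hLH⟩, hL.2⟩
  have hsimple : ∀ M ∈ S, ∃ V ∈ A.linesThrough p, ∀ L' ∈ S, L' ≠ M → ¬ M ⊓ V ≤ L' :=
    fun M hM => A.exists_inf_not_le hp subset_rfl hSsub hcard (fun M hM N hN hne =>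
      (hmeet M (hSsub hM) N (hSsub hN) hne).exists) hM
  by_contra hn2
  have hall : ∀ M ∈ S, H ∈ A.linesThrough p ∧ ∀ L' ∈ S, L' ≠ M → ¬ M ⊓ H ≤ L' := fun M hM => by
    obtain ⟨V, hV, h⟩ := hsimple M hM
    have hVH : V = H := by
      by_contra hVH
      exact hn2 (double M hM V hV hVH h)
    exact ⟨hVH ▸ hV, hVH ▸ h⟩
  have hHp := (hall L hLS).1
  -- No two lines of `S` meet on `H`, since each cuts `H` in a point of its own.
  have hmeet' : ∀ M ∈ S, ∀ N ∈ S, M ≠ N → ∃ V ∈ A.linesThrough p \ {H}, M ⊓ N ≤ V := by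
    intro M hM N hN hne
    obtain ⟨V, ⟨hV, hle⟩, -⟩ := hmeet M (hSsub hM) N (hSsub hN) hne
    refine ⟨V, ⟨hV, ?_⟩, hle⟩
    rintro rfl
    refine (hall M hM).2 N hN hne.symm ?_
    rw [← inf_eq_inf_of_le A (hSsub hM) hV hN.1.1 hne hle]
    exact inf_le_right
  have hfin : (A.linesThrough p).Finite := A.finite_lines.subset fun M hM => hM.1
  have hcard' := Set.ncard_sdiff_singleton_add_one hHp hfin
  -- With a single line `V` left through `p`, all of `S` passes through `L ⊓ V`, giving a pencil.
  rcases Nat.lt_or_ge (A.linesThrough p \ {H}).ncard 2 with hlt | hge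
  · obtain ⟨V, hV⟩ := Set.ncard_eq_one.1 (show (A.linesThrough p \ {H}).ncard = 1 by omega)
    have hVp : V ∈ A.linesThrough p := (hV ▸ rfl : V ∈ A.linesThrough p \ {H}).1
    refine hpencil ⟨L ⊓ V, (A.inf_mem_points hLA hVp.1 fun h => hL.2 (h ▸ hVp)).2, ?_⟩
    intro M hM
    by_cases hMp : M ∈ A.linesThrough p
    · have : M ∈ A.linesThrough p \ {H} := ⟨hMp, hM.2⟩
      rw [hV] at this
      rw [Set.mem_singleton_iff.1 this]
      exact inf_le_right
    · rcases eq_or_ne L M with rfl | hne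
      · exact inf_le_left
      obtain ⟨V', hV', hle⟩ := hmeet' L hLS M ⟨hM, hMp⟩ hne
      rw [hV] at hV'
      rw [Set.mem_singleton_iff.1 hV'] at hle
      rw [← inf_eq_inf_of_le A hL hVp hM.1 hne hle]
      exact inf_le_right
  · obtain ⟨V, hV, h⟩ := A.exists_inf_not_le hp Set.sdiff_subset hSsub hge hmeet' hLS
    exact hn2 (double L hLS V hV.1 hV.2 h)

end Modular

end LineArrangement

theorem theorem4p4 (K : Type*) [Field K] [CharZero K] :
    (∀ (A : LineArrangement K) (p H : Submodule K (Fin 3 → K)),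
      A.IsModularPoint p → 1 ≤ A.mu p → H ∈ A.lines → ¬ (A.delete H).IsPencil →
        0 < (A.delete H).n2) ∧
    (∀ B : LineArrangement K, B.IsNearlySupersolvable → 0 < B.n2) := by
  refine ⟨fun A p H hmod hmu _ hpencil => LineArrangement.n2_delete_pos hmod hmu hpencil, ?_⟩
  rintro B ⟨hpencil, -, A, ⟨p, hmod⟩, H, -, rfl⟩
  exact LineArrangement.n2_delete_pos hmod (LineArrangement.one_le_mu hmod.1) hpencil
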